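/- Let $n\ge 0$, let $F_n$ be the free group on $X=\{x_1,\dots,x_n\}$, and let $\rho:F_n\to\mathbb{Z}^n$ be the abelianisation map sending $x_i$ to the $i$-th standard basis vector $v_i$. A palindrome is an element of $F_n$ represented by a word on $X^{\pm1}$ that equals its own reverse. A $\pi$-basis of $F_n$ is a set of palindromes that is a free basis of $F_n$, and a partial $\pi$-basis is a subset of a $\pi$-basis. The complex of partial $\pi$-bases $\mathcal{B}^{\pi}_n$ is the simplicial complex whose simplices are the nonempty partial $\pi$-bases $\{w_1,\dots,w_k\}$. The palindromic Torelli group $\mathcal{PI}_n$ is the group of automorphisms of $F_n$ that take each $x_i$ to a palindrome and act trivially on the abelianisation of $F_n$. An odd palindrome in $\mathbb{Z}^n$ is a vector of the form $2w\pm v_i$ with $w\in\mathbb{Z}^n$, $1\le i\le n$; a $\pi$-basis of $\mathbb{Z}^n$ is a free abelian basis consisting of odd palindromes; and $\mathcal{B}^{\pi}_n(\mathbb{Z})$ is the simplicial complex whose simplices are the nonempty subsets of $\pi$-bases of $\mathbb{Z}^n$. The group $\mathcal{PI}_n$ acts simplicially on $\mathcal{B}^{\pi}_n$. Let $\mathcal{B}^{\pi}_n/\mathcal{PI}_n$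 be the simplicial complex whose vertices are the $\mathcal{PI}_n$-orbits of vertices of $\mathcal{B}^{\pi}_n$ and whose simplices are the sets of orbits of the vertices of simplices of $\mathcal{B}^{\pi}_n$. Theorem. There is an isomorphism of simplicial complexes $$\mathcal{B}^{\pi}_n/\mathcal{PI}_n\;\cong\;\mathcal{B}^{\pi}_n(\mathbb{Z})$$ induced by abelianisation, that is, taking the orbit of each vertex $w$ to $\rho(w)$. Moreover, $\mathcal{B}^{\pi}_n/\mathcal{PI}_n$ is the genuine orbit space: distinct vertices of a simplex of $\mathcal{B}^{\pi}_n$ lie in distinct $\mathcal{PI}_n$-orbits, and two simplices of $\mathcal{B}^{\pi}_n$ whose vertices represent the same set of orbits lie in the same $\mathcal{PI}_n$-orbit. -/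

import Mathlib

namespace PalindromicTorelli

/-! ### Simplicial complexes, their quotients and their isomorphisms -/

/-- The set of vertices of a simplicial complex. -/
def vertices {α : Type*} (K : PreAbstractSimplicialComplex α) : Set α :=
  {v | {v} ∈ K.faces}

/-- An isomorphism of simplicial complexes: a bijection of the vertex sets under which a finite
set of vertices spans a simplex if and only if its image does. -/
structure SimplicialIso {α β : Type*} (K : PreAbstractSimplicialComplex α)
    (L : PreAbstractSimplicialComplex β) where
  toEquiv : vertices K ≃ vertices L
  map_faces_iff : ∀ s : Finset (vertices K),
    s.map (Function.Embedding.subtype _) ∈ K.faces ↔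
      (s.map toEquiv.toEmbedding).map (Function.Embedding.subtype _) ∈ L.faces

/-- The action of `G` on `α` takes simplices of `K` to simplices of `K`. -/
def ActsSimplicially (G : Type*) {α : Type*} [Group G] [MulAction G α]
    (K : PreAbstractSimplicialComplex α) : Prop :=
  ∀ (g : G), ∀ s ∈ K.faces, s.map (MulAction.toPerm g).toEmbedding ∈ K.faces

open Classical in
/-- The quotient of a simplicial complex by a simplicial group action: the vertices are the
orbits of vertices, and a set of orbits spans a simplex if it is the set of orbits of the
vertices of some simplex of `K`. -/
noncomputable def quotientComplex (G : Type*) {α : Type*} [Group G] [MulAction G α]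
    (K : PreAbstractSimplicialComplex α) (_hK : ActsSimplicially G K) :
    PreAbstractSimplicialComplex (MulAction.orbitRel.Quotient G α) :=
  K.map (fun v => (Quotient.mk _ v : MulAction.orbitRel.Quotient G α))

/-- The vertex of the quotient complex given by the orbit of a vertex. -/
noncomputable def quotientVertex (G : Type*) {α : Type*} [Group G] [MulAction G α]
    (K : PreAbstractSimplicialComplex α) (hK : ActsSimplicially G K) (v : vertices K) :
    vertices (quotientComplex G K hK) :=
  ⟨Quotient.mk _ v.1, by
    classical
    exact ⟨{v.1}, v.2, by simp⟩⟩

/-! ### Palindromes and palindromic automorphisms -/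

/-- An element of the free group is a palindrome if it is represented by some (not necessarily
reduced) word in the letters and their inverses that equals its own reverse. -/
def IsPalindrome {α : Type*} (g : FreeGroup α) : Prop :=
  ∃ L : List (α × Bool), L.reverse = L ∧ FreeGroup.mk L = g

/-- The endomorphism of the free group that inverts each free generator. -/
def inversion (α : Type*) : FreeGroup α →* FreeGroup α :=
  FreeGroup.lift (fun x => (FreeGroup.of x)⁻¹)

theorem inversion_mk {α : Type*} (L : List (α × Bool)) :
    inversion α (FreeGroup.mk L) = FreeGroup.mk (L.map fun p => (p.1, !p.2)) := by
  induction L with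
  | nil => rfl
  | cons p L ih =>
    have h1 : FreeGroup.mk (p :: L) = FreeGroup.mk [p] * FreeGroup.mk L := by
      simp
    have h2 : FreeGroup.mk ((p :: L).map fun p => (p.1, !p.2)) =
        FreeGroup.mk [(p.1, !p.2)] * FreeGroup.mk (L.map fun p => (p.1, !p.2)) := by
      simp
    rw [h1, map_mul, ih, h2]
    congr 1
    obtain ⟨x, b⟩ := p
    cases b <;> simp [inversion, FreeGroup.of, FreeGroup.invRev]

theorem isPalindrome_iff {α : Type*} (g : FreeGroup α) :
    IsPalindrome g ↔ inversion α g = g⁻¹ := by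
  classical
  constructor
  · rintro ⟨L, hL, rfl⟩
    rw [inversion_mk, FreeGroup.inv_mk, FreeGroup.invRev, ← List.map_reverse, hL]
  · intro h
    refine ⟨g.toWord, ?_, FreeGroup.mk_toWord⟩
    have hr : FreeGroup.IsReduced g.toWord := FreeGroup.isReduced_toWord
    have hm : FreeGroup.IsReduced (g.toWord.map fun p => (p.1, !p.2)) := by
      unfold FreeGroup.IsReduced at hr ⊢
      rw [List.isChain_map]
      exact hr.imp (by intro a b hab h; simp [hab h])
    have hm' : FreeGroup.IsReduced (g.toWord.map fun p => (p.1, !p.2)).reverse := by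
      unfold FreeGroup.IsReduced at hm ⊢
      rw [List.isChain_reverse]
      exact hm.imp (by intro a b hab h; exact (hab h.symm).symm)
    have h' : FreeGroup.mk (g.toWord.map fun p => (p.1, !p.2)) =
        FreeGroup.mk (g.toWord.map fun p => (p.1, !p.2)).reverse := by
      rw [← inversion_mk, FreeGroup.mk_toWord, h]
      conv_lhs => rw [← FreeGroup.mk_toWord (x := g), FreeGroup.inv_mk, FreeGroup.invRev]
    have h2 := congrArg FreeGroup.toWord h'
    rw [FreeGroup.toWord_mk, FreeGroup.toWord_mk, hm.reduce_eq, hm'.reduce_eq,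
      ← List.map_reverse] at h2
    refine (List.map_injective_iff.2 ?_ h2).symm
    rintro ⟨a, b⟩ ⟨c, d⟩ hab
    simpa using hab

theorem commutes_iff {α : Type*} (φ : MulAut (FreeGroup α)) :
    (∀ x : α, IsPalindrome (φ (FreeGroup.of x))) ↔
      ∀ g, inversion α (φ g) = φ (inversion α g) := by
  constructor
  · intro h
    have : (inversion α).comp φ.toMonoidHom = φ.toMonoidHom.comp (inversion α) := by
      ext x
      have := (isPalindrome_iff _).1 (h x)
      simpa [inversion] using this
    exact fun g => DFunLike.congr_fun this g
  · intro h x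
    rw [isPalindrome_iff, h]
    simp [inversion]

/-- The palindromic automorphism group of the free group on `x_1, …, x_n`: the automorphisms
taking each `x_i` to a palindrome. -/
def palindromicAut (n : ℕ) : Subgroup (MulAut (FreeGroup (Fin n))) where
  carrier := {φ | ∀ i : Fin n, IsPalindrome (φ (FreeGroup.of i))}
  one_mem' := fun i => ⟨[(i, true)], rfl, rfl⟩
  mul_mem' := by
    intro φ ψ hφ hψ
    rw [Set.mem_ofPred_eq, commutes_iff] at *
    intro g
    rw [MulAut.mul_apply, MulAut.mul_apply, hφ, hψ]
  inv_mem' := by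
    intro φ hφ
    rw [Set.mem_ofPred_eq, commutes_iff] at *
    intro g
    apply φ.injective
    rw [← hφ, MulAut.apply_inv_self, MulAut.apply_inv_self]

/-- The abelianisation map `F_n → ℤⁿ`, taking `x_i` to the `i`-th standard basis vector. -/
def abMap (n : ℕ) : FreeGroup (Fin n) →* Multiplicative (Fin n → ℤ) :=
  FreeGroup.lift (fun i => Multiplicative.ofAdd (Pi.single i 1))

/-- The abelianisation map as a map to the additive group `ℤⁿ`. -/
def rho (n : ℕ) (w : FreeGroup (Fin n)) : Fin n → ℤ :=
  Multiplicative.toAdd (abMap n w)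

/-- The palindromic Torelli group: the palindromic automorphisms of `F_n` that act trivially on
the abelianisation of `F_n`. -/
def palindromicTorelli (n : ℕ) : Subgroup (MulAut (FreeGroup (Fin n))) where
  carrier := {φ | φ ∈ palindromicAut n ∧ ∀ g, rho n (φ g) = rho n g}
  one_mem' := ⟨(palindromicAut n).one_mem, fun _ => rfl⟩
  mul_mem' := by
    rintro φ ψ ⟨h1, h2⟩ ⟨h3, h4⟩
    exact ⟨(palindromicAut n).mul_mem h1 h3, fun g => by rw [MulAut.mul_apply, h2, h4]⟩
  inv_mem' := by
    rintro φ ⟨h1, h2⟩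
    exact ⟨(palindromicAut n).inv_mem h1, fun g => by rw [← h2, MulAut.apply_inv_self]⟩

/-! ### The complex of partial π-bases of the free group -/

/-- A π-basis of `F_n`: a set of palindromes that is a free basis of `F_n`. -/
def IsPiBasis (n : ℕ) (B : Set (FreeGroup (Fin n))) : Prop :=
  (∀ w ∈ B, IsPalindrome w) ∧
    ∃ b : FreeGroupBasis B (FreeGroup (Fin n)), ∀ w : B, b w = w

/-- The complex of partial π-bases of `F_n`: its simplices are the nonempty finite sets that
can be extended to a π-basis. -/
def piComplex (n : ℕ) : PreAbstractSimplicialComplex (FreeGroup (Fin n)) where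
  faces := {s | s.Nonempty ∧ ∃ B, IsPiBasis n B ∧ (s : Set (FreeGroup (Fin n))) ⊆ B}
  isRelLowerSet_faces := by
    rintro s ⟨hs, B, hB, hsB⟩
    exact ⟨hs, fun t hts ht => ⟨ht, B, hB, (Finset.coe_subset.2 hts).trans hsB⟩⟩

theorem IsPiBasis.image {n : ℕ} {B : Set (FreeGroup (Fin n))} (hB : IsPiBasis n B)
    {φ : MulAut (FreeGroup (Fin n))} (hφ : φ ∈ palindromicAut n) : IsPiBasis n (φ '' B) := by
  obtain ⟨hpal, b, hb⟩ := hB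
  have hc := (commutes_iff φ).1 hφ
  refine ⟨?_, ?_⟩
  · rintro _ ⟨w, hw, rfl⟩
    rw [isPalindrome_iff, hc, (isPalindrome_iff w).1 (hpal w hw), map_inv]
  · refine ⟨(b.map φ).reindex (φ.toEquiv.image B), ?_⟩
    rintro ⟨_, w, hw, rfl⟩
    have : (φ.toEquiv.image B).symm ⟨φ w, w, hw, rfl⟩ = ⟨w, hw⟩ := by
      rw [Equiv.symm_apply_eq]; rfl
    simp only [FreeGroupBasis.reindex_apply, FreeGroupBasis.map_apply]
    erw [this, hb]

/-- The palindromic Torelli group acts simplicially on the complex of partial π-bases. -/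
theorem actsSimplicially (n : ℕ) : ActsSimplicially (palindromicTorelli n) (piComplex n) := by
  rintro ⟨φ, hφ⟩ s ⟨hs, B, hB, hsB⟩
  refine ⟨hs.map, φ '' B, hB.image hφ.1, ?_⟩
  rw [Finset.coe_map]
  exact Set.image_mono hsB

/-! ### The complex of partial π-bases of `ℤⁿ` -/

/-- An element of `ℤⁿ` is an odd palindrome on the standard basis `v_1, …, v_n` if it is of the
form `w^rev v_i^{±1} w` in multiplicative notation; as `w^rev = w` in `ℤⁿ`, this reads
`w ± v_i + w` in additive notation. -/
def IsOddPalindromeZ {n : ℕ} (u : Fin n → ℤ) : Prop :=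
  ∃ (w : Fin n → ℤ) (i : Fin n) (ε : ℤˣ), u = w + Pi.single i (ε : ℤ) + w

/-- A π-basis of `ℤⁿ`: a set of odd palindromes that is a free abelian basis of `ℤⁿ`. -/
def IsPiBasisZ (n : ℕ) (B : Set (Fin n → ℤ)) : Prop :=
  (∀ u ∈ B, IsOddPalindromeZ u) ∧
    ∃ b : Module.Basis B ℤ (Fin n → ℤ), ∀ u : B, b u = u

/-- The complex of partial π-bases of `ℤⁿ`: its simplices are the nonempty finite sets that can
be extended to a π-basis. -/
def piComplexZ (n : ℕ) : PreAbstractSimplicialComplex (Fin n → ℤ) where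
  faces := {s | s.Nonempty ∧ ∃ B, IsPiBasisZ n B ∧ (s : Set (Fin n → ℤ)) ⊆ B}
  isRelLowerSet_faces := by
    rintro s ⟨hs, B, hB, hsB⟩
    exact ⟨hs, fun t hts ht => ⟨ht, B, hB, (Finset.coe_subset.2 hts).trans hsB⟩⟩

end PalindromicTorelli

namespace PalindromicTorelli

variable {n : ℕ}

/-! ### The action of automorphisms on the abelianisation -/

/-! Everything rests on reduction modulo two. A palindrome abelianises to a vector that is zero or a
standard basis vector modulo two, so a π-basis of `F_n`, suitably ordered, is the image of the
standard basis under a palindromic automorphism acting on `ℤⁿ` as an element of `levelTwo n`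
(`IsPiBasis.exists_aut`). Likewise the π-bases of `ℤⁿ` are the images of the standard basis under
`levelTwo n`. The class modulo two recovers the index of each basis element, so `rho` is injective
on a π-basis.

The main work is a relative lifting statement, `mem_liftable_of_mem_levelTwo`: a level two matrix
fixing some `v_i` comes from a palindromic automorphism fixing the corresponding `x_i`. It is a
Euclidean algorithm on columns, using `x_b ↦ x_a ^ m x_b x_a ^ m` and inversions.

Hence a partial π-basis of `F_n` extends over any π-basis of `ℤⁿ` containing its image
(`IsPiBasis.exists_lift`). Extending the empty set shows that simplices of `ℤⁿ` lift. If two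
simplices have the same image, extend them to π-bases with the same image; these differ by a Torelli
element (`IsPiBasis.exists_torelli`), which carries one simplex to the other. -/

@[simp]
theorem rho_of (i : Fin n) : rho n (FreeGroup.of i) = Pi.single i 1 := by
  simp [rho, abMap]

@[simp]
theorem rho_one : rho n 1 = 0 := by simp [rho]

@[simp]
theorem rho_mul (g h : FreeGroup (Fin n)) : rho n (g * h) = rho n g + rho n h := by
  simp [rho]

@[simp]
theorem rho_inv (g : FreeGroup (Fin n)) : rho n g⁻¹ = -rho n g := by
  simp [rho]

@[simp]
theorem rho_zpow (g : FreeGroup (Fin n)) (m : ℤ) : rho n (g ^ m) = m • rho n g := by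
  simp [rho]

/-- The linear map of `ℤⁿ` induced by an endomorphism of `F_n`. -/
noncomputable def abLin (f : FreeGroup (Fin n) →* FreeGroup (Fin n)) :
    Module.End ℤ (Fin n → ℤ) :=
  (Pi.basisFun ℤ (Fin n)).constr ℤ fun i => rho n (f (FreeGroup.of i))

theorem abLin_single (f : FreeGroup (Fin n) →* FreeGroup (Fin n)) (i : Fin n) :
    abLin f (Pi.single i 1) = rho n (f (FreeGroup.of i)) := by
  have := (Pi.basisFun ℤ (Fin n)).constr_basis ℤ (fun i => rho n (f (FreeGroup.of i))) i
  rwa [Pi.basisFun_apply] at this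

theorem abLin_rho (f : FreeGroup (Fin n) →* FreeGroup (Fin n)) (g : FreeGroup (Fin n)) :
    abLin f (rho n g) = rho n (f g) := by
  induction g using FreeGroup.induction_on with
  | C1 => simp
  | of i => rw [rho_of, abLin_single]
  | inv_of i h => rw [rho_inv, map_neg, map_inv, rho_inv, h]
  | mul g h hg hh => rw [rho_mul, map_add, map_mul, rho_mul, hg, hh]

theorem linearMap_ext_single {M : Type*} [AddCommGroup M] {f g : (Fin n → ℤ) →ₗ[ℤ] M}
    (h : ∀ i, f (Pi.single i 1) = g (Pi.single i 1)) : f = g :=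
  (Pi.basisFun ℤ (Fin n)).ext fun i => by simpa using h i

/-- The action of automorphisms of `F_n` on `ℤⁿ`, as a homomorphism. -/
noncomputable def abAut (n : ℕ) :
    MulAut (FreeGroup (Fin n)) →* ((Fin n → ℤ) ≃ₗ[ℤ] (Fin n → ℤ)) :=
  -- A monoid homomorphism from a group lands in the units, so invertibility of the induced map
  -- needs no separate argument.
  (LinearMap.GeneralLinearGroup.generalLinearEquiv ℤ (Fin n → ℤ)).toMonoidHom.comp
    (MonoidHom.toHomUnits
      { toFun := fun φ : MulAut (FreeGroup (Fin n)) => abLin φ.toMonoidHom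
        map_one' := linearMap_ext_single fun i => by rw [abLin_single]; simp
        map_mul' := fun φ ψ => linearMap_ext_single fun i => by
          rw [abLin_single, Module.End.mul_apply, abLin_single, abLin_rho]; rfl })

theorem abAut_rho (φ : MulAut (FreeGroup (Fin n))) (g : FreeGroup (Fin n)) :
    abAut n φ (rho n g) = rho n (φ g) :=
  abLin_rho φ.toMonoidHom g

theorem abAut_single (φ : MulAut (FreeGroup (Fin n))) (i : Fin n) :
    abAut n φ (Pi.single i 1) = rho n (φ (FreeGroup.of i)) := by
  rw [← rho_of, abAut_rho]

theorem linearEquiv_ext_single {A B : (Fin n → ℤ) ≃ₗ[ℤ] (Fin n → ℤ)}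
    (h : ∀ i, A (Pi.single i 1) = B (Pi.single i 1)) : A = B :=
  LinearEquiv.toLinearMap_injective (linearMap_ext_single h)

theorem apply_eq_sum_single (f : (Fin n → ℤ) →ₗ[ℤ] ℤ) (v : Fin n → ℤ) :
    f v = ∑ i, v i * f (Pi.single i 1) := by
  conv_lhs => rw [← (Pi.basisFun ℤ (Fin n)).sum_repr v, map_sum]
  simp only [map_smul, Pi.basisFun_repr, Pi.basisFun_apply, smul_eq_mul]

/-! ### The level two congruence subgroup -/

/-- The automorphisms of `ℤⁿ` that are congruent to the identity modulo two. -/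
def levelTwo (n : ℕ) : Subgroup ((Fin n → ℤ) ≃ₗ[ℤ] (Fin n → ℤ)) where
  carrier := {A | ∀ v k, 2 ∣ A v k - v k}
  one_mem' := fun v k => by simp
  mul_mem' := by
    intro A B hA hB v k
    have := dvd_add (hA (B v) k) (hB v k)
    simpa using this
  inv_mem' := by
    intro A hA v k
    have := hA (A⁻¹ v) k
    rw [← LinearEquiv.mul_apply, mul_inv_cancel] at this
    exact (dvd_sub_comm).1 this

theorem mem_levelTwo_of_single {A : (Fin n → ℤ) ≃ₗ[ℤ] (Fin n → ℤ)}
    (h : ∀ i k, 2 ∣ A (Pi.single i 1) k - (Pi.single i 1 : Fin n → ℤ) k) : A ∈ levelTwo n := by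
  intro v k
  have := apply_eq_sum_single ((LinearMap.proj k).comp (A.toLinearMap - LinearMap.id)) v
  simp only [LinearMap.comp_apply, LinearMap.sub_apply, LinearMap.proj_apply, Pi.sub_apply,
    LinearMap.id_apply, LinearEquiv.coe_coe] at this
  rw [this]
  exact Finset.dvd_sum fun i _ => Dvd.dvd.mul_left (h i k) _

/-! ### Elementary palindromic automorphisms -/

/-- The endomorphism of the free group sending `x_j` to `w` and fixing the other generators. -/
def replaceGen (j : Fin n) (w : FreeGroup (Fin n)) : FreeGroup (Fin n) →* FreeGroup (Fin n) :=
  FreeGroup.lift (Function.update FreeGroup.of j w)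

theorem replaceGen_self (j : Fin n) (w : FreeGroup (Fin n)) :
    replaceGen j w (FreeGroup.of j) = w := by simp [replaceGen]

theorem replaceGen_of_ne {i j : Fin n} (h : i ≠ j) (w : FreeGroup (Fin n)) :
    replaceGen j w (FreeGroup.of i) = FreeGroup.of i := by simp [replaceGen, h]

theorem replaceGen_comp (j : Fin n) (w w' : FreeGroup (Fin n))
    (h : replaceGen j w w' = FreeGroup.of j) :
    (replaceGen j w).comp (replaceGen j w') = MonoidHom.id _ := by
  ext i
  by_cases hi : i = j
  · subst hi
    simpa [replaceGen_self] using h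
  · simp [replaceGen_of_ne hi]

/-- The automorphism inverting the generator `x_j` and fixing the others. -/
def invertGen (j : Fin n) : MulAut (FreeGroup (Fin n)) :=
  MonoidHom.toMulEquiv (replaceGen j (FreeGroup.of j)⁻¹) (replaceGen j (FreeGroup.of j)⁻¹)
    (replaceGen_comp _ _ _ (by simp [replaceGen_self]))
    (replaceGen_comp _ _ _ (by simp [replaceGen_self]))

/-- The word `x_a ^ m x_b x_a ^ m`. -/
def sandwich (a b : Fin n) (m : ℤ) : FreeGroup (Fin n) :=
  FreeGroup.of a ^ m * FreeGroup.of b * FreeGroup.of a ^ m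

theorem replaceGen_sandwich {a b : Fin n} (hab : a ≠ b) (m k : ℤ) (h : m + k = 0) :
    replaceGen b (sandwich a b m) (sandwich a b k) = FreeGroup.of b := by
  obtain rfl : k = -m := by omega
  rw [sandwich.eq_def a b (-m), map_mul, map_mul, map_zpow, replaceGen_of_ne hab, replaceGen_self,
    sandwich]
  group

/-- The automorphism sending `x_b` to `x_a ^ m x_b x_a ^ m` and fixing the other generators. -/
def sandwichAut {a b : Fin n} (hab : a ≠ b) (m : ℤ) : MulAut (FreeGroup (Fin n)) :=
  MonoidHom.toMulEquiv (replaceGen b (sandwich a b m)) (replaceGen b (sandwich a b (-m)))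
    (replaceGen_comp _ _ _ (replaceGen_sandwich hab _ _ (by omega)))
    (replaceGen_comp _ _ _ (replaceGen_sandwich hab _ _ (by omega)))

theorem invertGen_of (i j : Fin n) :
    invertGen j (FreeGroup.of i) = if i = j then (FreeGroup.of j)⁻¹ else FreeGroup.of i := by
  change replaceGen j _ (FreeGroup.of i) = _
  split_ifs with h
  · rw [h, replaceGen_self]
  · rw [replaceGen_of_ne h]

theorem sandwichAut_of {a b : Fin n} (hab : a ≠ b) (m : ℤ) (i : Fin n) :
    sandwichAut hab m (FreeGroup.of i) = if i = b then sandwich a b m else FreeGroup.of i := by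
  change replaceGen b _ (FreeGroup.of i) = _
  split_ifs with h
  · rw [h, replaceGen_self]
  · rw [replaceGen_of_ne h]

theorem isPalindrome_of (i : Fin n) : IsPalindrome (FreeGroup.of i) := ⟨[(i, true)], rfl, rfl⟩

theorem invertGen_mem (j : Fin n) : invertGen j ∈ palindromicAut n := by
  intro i
  rw [invertGen_of]
  split_ifs
  · rw [isPalindrome_iff]; simp [inversion]
  · exact isPalindrome_of i

theorem sandwichAut_mem {a b : Fin n} (hab : a ≠ b) (m : ℤ) :
    sandwichAut hab m ∈ palindromicAut n := by
  intro i
  rw [sandwichAut_of]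
  split_ifs
  · rw [isPalindrome_iff]; simp [inversion, sandwich, mul_assoc]
  · exact isPalindrome_of i

theorem abAut_sandwichAut {a b : Fin n} (hab : a ≠ b) (m : ℤ) (v : Fin n → ℤ) :
    abAut n (sandwichAut hab m) v = v + Pi.single a (2 * m * v b) := by
  have : (abAut n (sandwichAut hab m)).toLinearMap =
      LinearMap.id + (LinearMap.single ℤ (fun _ => ℤ) a).comp
        ((2 * m) • LinearMap.proj (R := ℤ) (φ := fun _ : Fin n => ℤ) b) := by
    refine linearMap_ext_single fun i => ?_
    rw [LinearEquiv.coe_coe, abAut_single, sandwichAut_of]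
    split_ifs with h
    · subst h
      simp only [sandwich, rho_mul, rho_zpow, rho_of]
      ext k
      simp [Pi.single_apply]
      split_ifs <;> ring
    · simp [Ne.symm h]
  have := LinearMap.congr_fun this v
  simpa using this

theorem abAut_invertGen (j : Fin n) (v : Fin n → ℤ) :
    abAut n (invertGen j) v = v + Pi.single j (-2 * v j) := by
  have : (abAut n (invertGen j)).toLinearMap =
      LinearMap.id + (LinearMap.single ℤ (fun _ => ℤ) j).comp
        ((-2 : ℤ) • LinearMap.proj (R := ℤ) (φ := fun _ : Fin n => ℤ) j) := by
    refine linearMap_ext_single fun i => ?_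
    rw [LinearEquiv.coe_coe, abAut_single, invertGen_of]
    split_ifs with h
    · subst h
      ext k
      simp [Pi.single_apply]
      split_ifs <;> simp
    · simp [Ne.symm h]
  have := LinearMap.congr_fun this v
  simpa [← Pi.single_neg] using this

theorem abAut_sandwichAut_mem {a b : Fin n} (hab : a ≠ b) (m : ℤ) :
    abAut n (sandwichAut hab m) ∈ levelTwo n := by
  intro v k
  rw [abAut_sandwichAut, Pi.add_apply, add_sub_cancel_left, Pi.single_apply]
  split_ifs
  · exact ⟨m * v b, by ring⟩
  · simp

theorem abAut_invertGen_mem (j : Fin n) : abAut n (invertGen j) ∈ levelTwo n := by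
  intro v k
  rw [abAut_invertGen, Pi.add_apply, add_sub_cancel_left, Pi.single_apply]
  split_ifs
  · exact ⟨-v j, by ring⟩
  · simp

/-! ### Lifting automorphisms of `ℤⁿ` to palindromic automorphisms -/

/-- The automorphisms of `ℤⁿ` induced by palindromic automorphisms of `F_n` that fix `x_i` for
each `i` in `S`. -/
noncomputable def liftable (S : Finset (Fin n)) : Subgroup ((Fin n → ℤ) ≃ₗ[ℤ] (Fin n → ℤ)) :=
  (palindromicAut n ⊓ fixingSubgroup (MulAut (FreeGroup (Fin n)))
    (FreeGroup.of '' (S : Set (Fin n)))).map (abAut n)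

theorem mem_liftable {S : Finset (Fin n)} {A : (Fin n → ℤ) ≃ₗ[ℤ] (Fin n → ℤ)} :
    A ∈ liftable S ↔ ∃ φ ∈ palindromicAut n, (∀ i ∈ S, φ (FreeGroup.of i) = FreeGroup.of i) ∧
      abAut n φ = A := by
  simp [liftable, mem_fixingSubgroup_iff, and_assoc]

theorem liftable_anti {S T : Finset (Fin n)} (h : S ⊆ T) : liftable T ≤ liftable S := by
  intro A hA
  rw [mem_liftable] at hA ⊢
  obtain ⟨φ, hφ, hT, rfl⟩ := hA
  exact ⟨φ, hφ, fun i hi => hT i (h hi), rfl⟩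

theorem abAut_sandwichAut_mem_liftable {S : Finset (Fin n)} {a b : Fin n} (hab : a ≠ b)
    (hb : b ∉ S) (m : ℤ) : abAut n (sandwichAut hab m) ∈ liftable S :=
  mem_liftable.2 ⟨_, sandwichAut_mem hab m, fun i hi => by
    rw [sandwichAut_of, if_neg (by rintro rfl; exact hb hi)], rfl⟩

theorem abAut_invertGen_mem_liftable {S : Finset (Fin n)} {j : Fin n} (hj : j ∉ S) :
    abAut n (invertGen j) ∈ liftable S :=
  mem_liftable.2 ⟨_, invertGen_mem j, fun i hi => by
    rw [invertGen_of, if_neg (by rintro rfl; exact hj hi)], rfl⟩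

/-- One step of division with even multipliers: with the sign of `m = ±1` chosen opposite to that of
`x * y`, the new absolute value is `||x| - 2|y||`, which is below `|x|` because `0 < |y| < |x|`. -/
theorem exists_abs_add_two_mul_lt {x y : ℤ} (hy : y ≠ 0) (hxy : |y| < |x|) :
    ∃ m : ℤ, |x + 2 * m * y| < |x| := by
  by_cases h : 0 ≤ x * y
  · refine ⟨-1, ?_⟩
    rw [abs_lt] at *
    rcases lt_or_gt_of_ne hy with h1 | h1
    · have : x ≤ 0 := by nlinarith
      rw [abs_of_nonpos this] at *; constructor <;> linarith
    · have : 0 ≤ x := by nlinarith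
      rw [abs_of_nonneg this] at *; constructor <;> linarith
  · refine ⟨1, ?_⟩
    rw [abs_lt] at *
    rcases lt_or_gt_of_ne hy with h1 | h1
    · have : 0 ≤ x := by nlinarith
      rw [abs_of_nonneg this] at *; constructor <;> linarith
    · have : x ≤ 0 := by nlinarith
      rw [abs_of_nonpos this] at *; constructor <;> linarith

theorem sum_natAbs_add_single_lt {v : Fin n → ℤ} {a : Fin n} {c : ℤ} (h : |v a + c| < |v a|) :
    ∑ k, ((v + Pi.single a c : Fin n → ℤ) k).natAbs < ∑ k, (v k).natAbs := by
  rw [Int.abs_eq_natAbs, Int.abs_eq_natAbs, Nat.cast_lt] at h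
  refine Finset.sum_lt_sum (fun k _ => ?_) ⟨a, Finset.mem_univ _, ?_⟩
  · by_cases hk : k = a
    · subst hk; simpa using h.le
    · simp [hk]
  · simpa using h

/-- If an automorphism fixes the basis vectors indexed by `S`, and the `j`-th basis vector is sent
to a vector whose `k`-th entry vanishes for `k ∉ insert j S`, then its `j`-th entry is a unit. -/
theorem isUnit_apply_single {S : Finset (Fin n)} {A : (Fin n → ℤ) ≃ₗ[ℤ] (Fin n → ℤ)}
    (hfix : ∀ i ∈ S, A (Pi.single i 1) = Pi.single i 1) {j : Fin n}
    (h0 : ∀ k ∉ S, k ≠ j → A (Pi.single j 1) k = 0) : IsUnit (A (Pi.single j 1) j) := by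
  -- Read off the `j`-th entry of `A⁻¹ (A v_j) = v_j`. Only the term `i = j` survives, since `A⁻¹`
  -- also fixes `v_i` for `i ∈ S`; so the entry in question divides 1.
  have h := apply_eq_sum_single ((LinearMap.proj j).comp A.symm.toLinearMap) (A (Pi.single j 1))
  rw [Finset.sum_eq_single j] at h
  · refine IsUnit.of_mul_eq_one _ (h.symm.trans ?_)
    simp
  · intro i _ hij
    by_cases hi : i ∈ S
    · have : A.symm (Pi.single i 1) = Pi.single i 1 := by
        rw [LinearEquiv.symm_apply_eq, hfix i hi]
      simp [this, hij.symm]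
    · simp [h0 i hi hij]
  · simp

/-- Euclidean algorithm on the `j`-th column, by induction on its ℓ¹-norm `N`, until it becomes
`±v_j`. Its `j`-th entry is odd and the others are even, so no other entry equals the `j`-th in
absolute value and one of the two can always reduce the other if nonzero. -/
theorem mem_liftable_of_insert {S : Finset (Fin n)} {j : Fin n} (hj : j ∉ S)
    (ih : ∀ A ∈ levelTwo n, (∀ i ∈ insert j S, A (Pi.single i 1) = Pi.single i 1) →
      A ∈ liftable (insert j S))
    (N : ℕ) (A : (Fin n → ℤ) ≃ₗ[ℤ] (Fin n → ℤ)) (hN : ∑ k, (A (Pi.single j 1) k).natAbs = N)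
    (hA : A ∈ levelTwo n) (hfix : ∀ i ∈ S, A (Pi.single i 1) = Pi.single i 1) :
    A ∈ liftable S := by
  induction N using Nat.strong_induction_on generalizing A with
  | _ N ihN =>
  set v := A (Pi.single j 1) with hv
  -- The move adds `2 * m` times entry `b` to entry `a` and changes only the generator `x_b`. Hence
  -- `b ∉ S` is required, while `a` may lie in `S`.
  have step : ∀ a b : Fin n, a ≠ b → b ∉ S → v b ≠ 0 → |v b| < |v a| → A ∈ liftable S := by
    intro a b hab hb hb0 hlt
    obtain ⟨m, hm⟩ := exists_abs_add_two_mul_lt hb0 hlt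
    have hE := abAut_sandwichAut_mem_liftable hab hb m
    rw [← Subgroup.mul_mem_cancel_left _ hE]
    refine ihN _ ?_ _ rfl (mul_mem (abAut_sandwichAut_mem hab m) hA) fun i hi => ?_
    · rw [← hN, LinearEquiv.mul_apply, abAut_sandwichAut, ← hv]
      exact sum_natAbs_add_single_lt hm
    · have : b ≠ i := by rintro rfl; exact hb hi
      rw [LinearEquiv.mul_apply, hfix i hi, abAut_sandwichAut]
      simp [this]
  have hodd : ∀ k, 2 ∣ v k - (Pi.single j 1 : Fin n → ℤ) k := hA _
  have hvj : v j ≠ 0 := by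
    have := hodd j
    rw [Pi.single_eq_same] at this
    omega
  by_cases h1 : ∃ a, a ≠ j ∧ |v j| < |v a|
  · obtain ⟨a, haj, hlt⟩ := h1
    exact step a j haj hj hvj hlt
  by_cases h2 : ∃ a, a ≠ j ∧ a ∉ S ∧ v a ≠ 0
  · obtain ⟨a, haj, haS, ha0⟩ := h2
    refine step j a haj.symm haS ha0 ?_
    have e1 := hodd j
    have e2 := hodd a
    rw [Pi.single_eq_same] at e1
    rw [Pi.single_eq_of_ne haj] at e2
    have := not_lt.1 (fun h => h1 ⟨a, haj, h⟩)
    refine lt_of_le_of_ne this fun h => ?_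
    rcases abs_eq_abs.1 h with h | h <;> omega
  -- No move is left: the entries outside `insert j S` vanish, so `v j` is a unit, and then every
  -- other entry is even of absolute value at most 1, hence zero.
  push Not at h1 h2
  have hunit : v j = 1 ∨ v j = -1 :=
    Int.isUnit_iff.1 (isUnit_apply_single hfix fun k hk hkj => h2 k hkj hk)
  have hzero : ∀ k, k ≠ j → v k = 0 := by
    intro k hk
    have e := hodd k
    rw [Pi.single_eq_of_ne hk] at e
    have h3 := abs_le.1 (h1 k hk)
    have h4 : |v j| = 1 := by rcases hunit with h | h <;> simp [h]
    rw [h4] at h3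
    omega
  have hvs : v = Pi.single j (v j) := by
    ext k
    by_cases hk : k = j
    · subst hk; simp
    · simp [hk, hzero k hk]
  have hle : liftable (insert j S) ≤ liftable S := liftable_anti (Finset.subset_insert _ _)
  rcases hunit with h | h
  · refine hle (ih A hA fun i hi => ?_)
    rcases Finset.mem_insert.1 hi with rfl | hi
    · rw [← hv, hvs, h]
    · exact hfix i hi
  · rw [← Subgroup.mul_mem_cancel_left _ (abAut_invertGen_mem_liftable hj)]
    refine hle (ih _ (mul_mem (abAut_invertGen_mem j) hA) fun i hi => ?_)
    rw [LinearEquiv.mul_apply]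
    rcases Finset.mem_insert.1 hi with rfl | hi
    · rw [← hv, hvs, h, abAut_invertGen, ← Pi.single_add]
      simp
    · have : j ≠ i := by rintro rfl; exact hj hi
      rw [hfix i hi, abAut_invertGen]
      simp [this]

/-- An automorphism of `ℤⁿ` that is trivial modulo two and fixes the basis vectors indexed by `S`
is induced by a palindromic automorphism of `F_n` that fixes the generators indexed by `S`. -/
theorem mem_liftable_of_mem_levelTwo (S : Finset (Fin n)) (A : (Fin n → ℤ) ≃ₗ[ℤ] (Fin n → ℤ))
    (hA : A ∈ levelTwo n) (hfix : ∀ i ∈ S, A (Pi.single i 1) = Pi.single i 1) :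
    A ∈ liftable S := by
  -- Columns are normalised one at a time; each normalised index joins the set of fixed generators.
  induction h : Sᶜ.card generalizing S A with
  | zero =>
    have hS : S = Finset.univ := by
      rwa [Finset.card_eq_zero, Finset.compl_eq_empty_iff] at h
    obtain rfl : A = 1 := linearEquiv_ext_single fun i => hfix i (by simp [hS])
    exact one_mem _
  | succ k ih =>
    obtain ⟨j, hj⟩ : Sᶜ.Nonempty := Finset.card_pos.1 (by omega)
    have hj' : j ∉ S := Finset.mem_compl.1 hj
    refine mem_liftable_of_insert hj' (fun B hB hB' => ih _ B hB hB' ?_) _ A rfl hA hfix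
    rw [Finset.compl_insert, Finset.card_erase_of_mem hj, h]
    rfl

/-! ### Palindromic bases and level two automorphisms -/

/-- Modulo two the columns are zero or standard basis vectors, and they must span. So each basis
vector occurs, and by counting each occurs exactly once and no column is zero. -/
theorem exists_perm_of_odd_or_even (A : (Fin n → ℤ) ≃ₗ[ℤ] (Fin n → ℤ))
    (h : ∀ i, (∀ k, 2 ∣ A (Pi.single i 1) k) ∨
      ∃ j, ∀ k, 2 ∣ A (Pi.single i 1) k - (Pi.single j 1 : Fin n → ℤ) k) :
    ∃ τ : Equiv.Perm (Fin n), ∀ j k,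
      2 ∣ A (Pi.single (τ j) 1) k - (Pi.single j 1 : Fin n → ℤ) k := by
  have key : ∀ j : Fin n, ∃ i, ∀ k,
      2 ∣ A (Pi.single i 1) k - (Pi.single j 1 : Fin n → ℤ) k := by
    intro j
    by_contra! hj
    have heven : ∀ i, 2 ∣ A (Pi.single i 1) j := by
      intro i
      rcases h i with h | ⟨j', h⟩
      · exact h j
      · have hne : j ≠ j' := by
          rintro rfl
          obtain ⟨k, hk⟩ := hj i
          exact hk (h k)
        simpa [hne] using h j
    -- If `v_j` were missed, every column would have even `j`-th entry, yet the `j`-th entry of `A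
    -- (A⁻¹ v_j)` is 1.
    have := apply_eq_sum_single ((LinearMap.proj j).comp A.toLinearMap)
      (A.symm (Pi.single j 1))
    have h2 : (2 : ℤ) ∣ 1 := by
      calc (2 : ℤ) ∣ _ := Finset.dvd_sum fun i _ => Dvd.dvd.mul_left (heven i) _
        _ = _ := this.symm
        _ = 1 := by simp
    omega
  choose f hf using key
  have hinj : Function.Injective f := by
    intro j j' hjj
    by_contra hne
    have h1 := hf j j
    have h2 := hf j' j
    rw [hjj, Pi.single_eq_same] at h1
    rw [Pi.single_eq_of_ne hne] at h2
    omega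
  exact ⟨Equiv.ofBijective f (Finite.injective_iff_bijective.1 hinj), hf⟩

/-- Stripping the equal outer letters of a palindrome changes its image by an even vector, leaving
the empty word or a single letter. The even case does occur, as for `x_i ^ 2`; only membership in a
basis excludes it. -/
theorem IsPalindrome.rho_even_or_odd {w : FreeGroup (Fin n)} (hw : IsPalindrome w) :
    (∀ k, 2 ∣ rho n w k) ∨ ∃ j, ∀ k, 2 ∣ rho n w k - (Pi.single j 1 : Fin n → ℤ) k := by
  obtain ⟨L, hL, rfl⟩ := hw
  have hL := List.Palindrome.of_reverse_eq hL
  induction hL with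
  | nil => exact Or.inl fun k => by simp [← FreeGroup.one_eq_mk]
  | singleton x =>
    obtain ⟨i, b⟩ := x
    refine Or.inr ⟨i, fun k => ?_⟩
    cases b
    · have : FreeGroup.mk [(i, false)] = (FreeGroup.of i)⁻¹ := rfl
      rw [this, rho_inv, rho_of]
      exact ⟨-(Pi.single i 1 : Fin n → ℤ) k, by simp; ring⟩
    · have : FreeGroup.mk [(i, true)] = FreeGroup.of i := rfl
      rw [this, rho_of]
      simp
  | @cons_concat x l hl ih =>
    have hx : FreeGroup.mk (x :: (l ++ [x])) =
        FreeGroup.mk [x] * FreeGroup.mk l * FreeGroup.mk [x] := by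
      simp
    have hr : ∀ k, rho n (FreeGroup.mk (x :: (l ++ [x]))) k =
        rho n (FreeGroup.mk l) k + 2 * rho n (FreeGroup.mk [x]) k := by
      intro k
      rw [hx, rho_mul, rho_mul, Pi.add_apply, Pi.add_apply]
      ring
    simp only [hr]
    rcases ih hl.reverse_eq with h | ⟨j, h⟩
    · exact Or.inl fun k => dvd_add (h k) (dvd_mul_right _ _)
    · refine Or.inr ⟨j, fun k => ?_⟩
      rw [add_sub_right_comm]
      exact dvd_add (h k) (dvd_mul_right _ _)

theorem isPiBasis_range {φ : MulAut (FreeGroup (Fin n))} (hφ : φ ∈ palindromicAut n) :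
    IsPiBasis n (Set.range fun i => φ (FreeGroup.of i)) := by
  refine ⟨?_, ((FreeGroupBasis.ofFreeGroup (Fin n)).map φ).reindex
    (Equiv.ofInjective _ (φ.injective.comp FreeGroup.of_injective)), ?_⟩
  · rintro _ ⟨i, rfl⟩
    exact hφ i
  · rintro ⟨_, i, rfl⟩
    rw [FreeGroupBasis.reindex_apply, FreeGroupBasis.map_apply, FreeGroupBasis.ofFreeGroup_apply]
    congr 2
    exact Equiv.ofInjective_symm_apply (φ.injective.comp FreeGroup.of_injective) i

theorem isOddPalindromeZ_of_congr {u : Fin n → ℤ} {j : Fin n}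
    (h : ∀ k, 2 ∣ u k - (Pi.single j 1 : Fin n → ℤ) k) : IsOddPalindromeZ u := by
  choose w hw using h
  refine ⟨w, j, 1, ?_⟩
  ext k
  have := hw k
  simp only [Units.val_one, Pi.add_apply]
  linarith

theorem IsOddPalindromeZ.exists_congr {u : Fin n → ℤ} (h : IsOddPalindromeZ u) :
    ∃ j, ∀ k, 2 ∣ u k - (Pi.single j 1 : Fin n → ℤ) k := by
  obtain ⟨w, j, ε, rfl⟩ := h
  refine ⟨j, fun k => ?_⟩
  simp only [Pi.add_apply, Pi.single_apply]
  rcases Int.units_eq_one_or ε with rfl | rfl <;> split_ifs <;> simp <;> omega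

/-- Both sides reduce modulo two to the basis vectors they came from. Thus comparing level two bases
as sets is the same as comparing them index by index. -/
theorem eq_of_levelTwo_of_apply_eq {A B : (Fin n → ℤ) ≃ₗ[ℤ] (Fin n → ℤ)} (hA : A ∈ levelTwo n)
    (hB : B ∈ levelTwo n) {i j : Fin n} (h : A (Pi.single i 1) = B (Pi.single j 1)) : i = j := by
  by_contra hne
  have h1 := hA (Pi.single i 1) i
  have h2 := hB (Pi.single j 1) i
  rw [Pi.single_eq_same] at h1
  rw [Pi.single_eq_of_ne hne, ← h] at h2
  omega

theorem isPiBasisZ_range {A : (Fin n → ℤ) ≃ₗ[ℤ] (Fin n → ℤ)} (hA : A ∈ levelTwo n) :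
    IsPiBasisZ n (Set.range fun i => A (Pi.single i 1)) := by
  have hinj : Function.Injective fun i : Fin n => A (Pi.single i 1) :=
    fun _ _ h => eq_of_levelTwo_of_apply_eq hA hA h
  refine ⟨?_, ((Pi.basisFun ℤ (Fin n)).map A).reindex (Equiv.ofInjective _ hinj), ?_⟩
  · rintro _ ⟨i, rfl⟩
    exact isOddPalindromeZ_of_congr (hA _)
  · rintro ⟨_, i, rfl⟩
    rw [Module.Basis.reindex_apply, Module.Basis.map_apply, Pi.basisFun_apply,
      Equiv.ofInjective_symm_apply hinj i]

/-- Every π-basis of `F_n` is the image of the standard basis under a palindromic automorphism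
whose action on `ℤⁿ` is trivial modulo two. -/
theorem IsPiBasis.exists_aut {B : Set (FreeGroup (Fin n))} (hB : IsPiBasis n B) :
    ∃ φ ∈ palindromicAut n, abAut n φ ∈ levelTwo n ∧
      B = Set.range fun i => φ (FreeGroup.of i) := by
  obtain ⟨hpal, b, hb⟩ := hB
  let σ : Fin n ≃ B := Equiv.ofFreeGroupEquiv b.repr
  let aut : (Fin n ≃ B) → MulAut (FreeGroup (Fin n)) := fun e =>
    (FreeGroup.freeGroupCongr e).trans b.repr.symm
  have haut : ∀ e i, aut e (FreeGroup.of i) = e i := fun e i => by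
    rw [← hb (e i)]
    simp only [aut, MulEquiv.trans_apply, FreeGroup.freeGroupCongr_apply, FreeGroup.map.of]
    rfl
  have hsingle : ∀ e i, abAut n (aut e) (Pi.single i 1) = rho n (e i) := fun e i => by
    rw [abAut_single, haut]
  -- The enumeration `σ` of `B` is arbitrary; `τ` reorders it so that the `j`-th element is
  -- congruent to `v_j`.
  obtain ⟨τ, hτ⟩ := exists_perm_of_odd_or_even (abAut n (aut σ)) fun i => by
    rw [hsingle]
    exact (hpal _ (σ i).2).rho_even_or_odd
  refine ⟨aut (τ.trans σ), fun i => ?_, mem_levelTwo_of_single fun i k => ?_, ?_⟩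
  · rw [haut]
    exact hpal _ (Subtype.coe_prop _)
  · have := hτ i k
    rw [hsingle] at this ⊢
    exact this
  · simp only [haut]
    rw [Set.range_comp' Subtype.val, (τ.trans σ).surjective.range_eq, Set.image_univ,
      Subtype.range_coe]

/-- Every π-basis of `ℤⁿ` is the image of the standard basis under an automorphism that is
trivial modulo two. -/
theorem IsPiBasisZ.exists_linearEquiv {B : Set (Fin n → ℤ)} (hB : IsPiBasisZ n B) :
    ∃ A ∈ levelTwo n, B = Set.range fun i => A (Pi.single i 1) := by
  obtain ⟨hodd, b, hb⟩ := hB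
  let σ : Fin n ≃ B := (Pi.basisFun ℤ (Fin n)).indexEquiv b
  have hsingle : ∀ (e : Fin n ≃ B) i, (Pi.basisFun ℤ (Fin n)).equiv b e (Pi.single i 1) = e i :=
    fun e i => by
      rw [← Pi.basisFun_apply, Module.Basis.equiv_apply, hb]
  obtain ⟨τ, hτ⟩ := exists_perm_of_odd_or_even ((Pi.basisFun ℤ (Fin n)).equiv b σ) fun i => by
    rw [hsingle]
    exact Or.inr (hodd _ (σ i).2).exists_congr
  refine ⟨(Pi.basisFun ℤ (Fin n)).equiv b (τ.trans σ), mem_levelTwo_of_single fun i k => ?_, ?_⟩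
  · have := hτ i k
    rw [hsingle] at this ⊢
    exact this
  · simp only [hsingle]
    rw [Set.range_comp' Subtype.val, (τ.trans σ).surjective.range_eq, Set.image_univ,
      Subtype.range_coe]

theorem IsPiBasis.image_rho {B : Set (FreeGroup (Fin n))} (hB : IsPiBasis n B) :
    IsPiBasisZ n (rho n '' B) := by
  obtain ⟨φ, -, h2, rfl⟩ := hB.exists_aut
  rw [← Set.range_comp']
  simpa only [abAut_single] using isPiBasisZ_range h2

theorem IsPiBasis.injOn_rho {B : Set (FreeGroup (Fin n))} (hB : IsPiBasis n B) :
    Set.InjOn (rho n) B := by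
  obtain ⟨φ, -, h2, rfl⟩ := hB.exists_aut
  rintro _ ⟨i, rfl⟩ _ ⟨j, rfl⟩ h
  simp only [← abAut_single] at h
  obtain rfl := eq_of_levelTwo_of_apply_eq h2 h2 h
  rfl

/-- A π-basis of `ℤⁿ` that contains the image of a partial π-basis of `F_n` lifts to a π-basis
of `F_n` containing that partial π-basis. -/
theorem IsPiBasis.exists_lift {B s : Set (FreeGroup (Fin n))} (hB : IsPiBasis n B) (hs : s ⊆ B)
    {C : Set (Fin n → ℤ)} (hC : IsPiBasisZ n C) (hsC : rho n '' s ⊆ C) :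
    ∃ D, IsPiBasis n D ∧ s ⊆ D ∧ rho n '' D = C := by
  classical
  obtain ⟨φ, hφ, hφ2, rfl⟩ := hB.exists_aut
  obtain ⟨A, hA, rfl⟩ := hC.exists_linearEquiv
  let S : Finset (Fin n) := Finset.univ.filter fun i => φ (FreeGroup.of i) ∈ s
  have hS : ∀ i, i ∈ S ↔ φ (FreeGroup.of i) ∈ s := fun i => by simp [S]
  -- On the indices in `S` the matrices `abAut n φ` and `A` agree, so `(abAut n φ)⁻¹ * A` fixes
  -- those basis vectors. Its lift `ψ` fixes the corresponding generators, and `φ * ψ` induces `A`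
  -- while keeping `s`.
  obtain ⟨ψ, hψ, hψS, hψA⟩ := mem_liftable.1 <| mem_liftable_of_mem_levelTwo S
    ((abAut n φ)⁻¹ * A) (mul_mem (inv_mem hφ2) hA) fun i hi => by
      obtain ⟨j, hj⟩ := hsC ⟨_, (hS i).1 hi, rfl⟩
      rw [← abAut_single] at hj
      obtain rfl := eq_of_levelTwo_of_apply_eq hA hφ2 hj
      rw [LinearEquiv.mul_apply]
      exact ((abAut n φ).symm_apply_eq).2 hj
  refine ⟨_, isPiBasis_range (mul_mem hφ hψ), ?_, ?_⟩
  · intro w hw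
    obtain ⟨i, rfl⟩ := hs hw
    refine ⟨i, ?_⟩
    simp only [MulAut.mul_apply, hψS i ((hS i).2 hw)]
  · rw [← Set.range_comp']
    simp only [← abAut_single, map_mul, hψA, mul_inv_cancel_left]

/-- Two π-bases of `F_n` with the same image in `ℤⁿ` differ by an element of the palindromic
Torelli group. -/
theorem IsPiBasis.exists_torelli {B C : Set (FreeGroup (Fin n))} (hB : IsPiBasis n B)
    (hC : IsPiBasis n C) (h : rho n '' B = rho n '' C) :
    ∃ φ ∈ palindromicTorelli n, ∀ w ∈ B, φ w ∈ C := by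
  obtain ⟨φ, hφ, hφ2, rfl⟩ := hB.exists_aut
  obtain ⟨ψ, hψ, hψ2, rfl⟩ := hC.exists_aut
  -- The two matrices have the same set of columns, and level two leaves only one way to order it.
  have key : abAut n φ = abAut n ψ := linearEquiv_ext_single fun i => by
    have : rho n (φ (FreeGroup.of i)) ∈ rho n '' Set.range fun i => ψ (FreeGroup.of i) :=
      h ▸ ⟨_, ⟨i, rfl⟩, rfl⟩
    obtain ⟨_, ⟨j, rfl⟩, hj⟩ := this
    simp only [← abAut_single] at hj
    obtain rfl := eq_of_levelTwo_of_apply_eq hψ2 hφ2 hj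
    exact hj.symm
  refine ⟨ψ * φ⁻¹, ⟨mul_mem hψ (inv_mem hφ), fun g => ?_⟩, ?_⟩
  · rw [← abAut_rho, map_mul, map_inv, key, mul_inv_cancel]
    rfl
  · rintro _ ⟨i, rfl⟩
    exact ⟨i, by simp⟩

/-! ### The quotient complex -/

theorem rho_eq_of_mem_orbit {v w : FreeGroup (Fin n)}
    (h : v ∈ MulAction.orbit (palindromicTorelli n) w) : rho n v = rho n w := by
  obtain ⟨φ, rfl⟩ := h
  exact φ.2.2 w

/-- Extend `s` to a π-basis `B`, then `t` to a π-basis `D` over the image of `B`. A Torelli element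
taking `B` into `D` preserves `rho`, and `rho` is injective on `D`, so it must take `s` to `t`. -/
theorem exists_torelli_of_image_rho_eq {s t : Finset (FreeGroup (Fin n))}
    (hs : s ∈ (piComplex n).faces) (ht : t ∈ (piComplex n).faces)
    (h : rho n '' (s : Set (FreeGroup (Fin n))) = rho n '' (t : Set (FreeGroup (Fin n)))) :
    ∃ φ : palindromicTorelli n, s.map (MulAction.toPerm φ).toEmbedding = t := by
  obtain ⟨-, B, hB, hsB⟩ := hs
  obtain ⟨-, C, hC, htC⟩ := ht
  obtain ⟨D, hD, htD, hDB⟩ := hC.exists_lift htC hB.image_rho (h ▸ Set.image_mono hsB)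
  obtain ⟨φ, hφ, hφD⟩ := hB.exists_torelli hD hDB.symm
  refine ⟨⟨φ, hφ⟩, Finset.coe_injective ?_⟩
  refine (hD.injOn_rho.image_eq_image_iff ?_ htD).1 ?_
  · rw [Finset.coe_map]
    rintro _ ⟨w, hw, rfl⟩
    exact hφD w (hsB hw)
  · rw [Finset.coe_map, ← h, Set.image_image]
    exact Set.image_congr fun w _ => hφ.2 w

theorem mem_orbit_of_rho_eq {v w : FreeGroup (Fin n)} (hv : v ∈ vertices (piComplex n))
    (hw : w ∈ vertices (piComplex n)) (h : rho n v = rho n w) :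
    v ∈ MulAction.orbit (palindromicTorelli n) w := by
  obtain ⟨φ, hφ⟩ := exists_torelli_of_image_rho_eq hw hv (by simp [h])
  rw [Finset.map_singleton, Finset.singleton_inj] at hφ
  exact ⟨φ, hφ⟩

theorem exists_face_lift {s : Finset (Fin n → ℤ)} (hs : s ∈ (piComplexZ n).faces) :
    ∃ t ∈ (piComplex n).faces, rho n '' (t : Set (FreeGroup (Fin n))) = s := by
  classical
  obtain ⟨hne, C, hC, hsC⟩ := hs
  -- The empty subset of the standard basis imposes no constraint, so any π-basis of `ℤⁿ` lifts.
  obtain ⟨D, hD, -, rfl⟩ := (isPiBasis_range (one_mem (palindromicAut n))).exists_lift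
    (Set.empty_subset _) hC (by simp)
  obtain ⟨t, htD, rfl⟩ := Finset.subset_set_image_iff.1 hsC
  exact ⟨t, ⟨Finset.image_nonempty.1 hne, D, hD, htD⟩, by simp⟩

theorem image_rho_mem_faces [DecidableEq (Fin n → ℤ)] {s : Finset (FreeGroup (Fin n))}
    (hs : s ∈ (piComplex n).faces) : s.image (rho n) ∈ (piComplexZ n).faces := by
  obtain ⟨hne, B, hB, hsB⟩ := hs
  refine ⟨hne.image _, _, hB.image_rho, ?_⟩
  rw [Finset.coe_image]
  exact Set.image_mono hsB

/-- The map induced by abelianisation on orbits of the palindromic Torelli group. -/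
def orbitRho (n : ℕ) :
    MulAction.orbitRel.Quotient (palindromicTorelli n) (FreeGroup (Fin n)) → (Fin n → ℤ) :=
  Quotient.lift (rho n) fun _ _ h => rho_eq_of_mem_orbit h

theorem exists_of_mem_vertices_quotient
    {q : MulAction.orbitRel.Quotient (palindromicTorelli n) (FreeGroup (Fin n))}
    (hq : q ∈ vertices (quotientComplex (palindromicTorelli n) (piComplex n)
      (actsSimplicially n))) :
    ∃ v ∈ vertices (piComplex n), Quotient.mk _ v = q := by
  classical
  obtain ⟨s, hs, h⟩ := hq
  have : q ∈ ({q} : Finset _) := Finset.mem_singleton_self q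
  rw [← h] at this
  obtain ⟨v, hv, rfl⟩ := Finset.mem_image.1 this
  exact ⟨v, ((piComplex n).isRelLowerSet_faces hs).2 (Finset.singleton_subset_iff.2 hv)
    (Finset.singleton_nonempty v), rfl⟩

theorem orbitRho_injOn : Set.InjOn (orbitRho n) (vertices (quotientComplex
    (palindromicTorelli n) (piComplex n) (actsSimplicially n))) := by
  intro q hq r hr h
  obtain ⟨v, hv, rfl⟩ := exists_of_mem_vertices_quotient hq
  obtain ⟨w, hw, rfl⟩ := exists_of_mem_vertices_quotient hr
  exact Quotient.sound (mem_orbit_of_rho_eq hv hw h)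

open Classical in
theorem image_orbitRho_mem_faces_iff
    (s : Finset (MulAction.orbitRel.Quotient (palindromicTorelli n) (FreeGroup (Fin n))))
    (hs : (s : Set _) ⊆ vertices (quotientComplex
      (palindromicTorelli n) (piComplex n) (actsSimplicially n))) :
    s.image (orbitRho n) ∈ (piComplexZ n).faces ↔
      s ∈ (quotientComplex (palindromicTorelli n) (piComplex n) (actsSimplicially n)).faces := by
  have himage : ∀ t : Finset (FreeGroup (Fin n)),
      (t.image (Quotient.mk _)).image (orbitRho n) = t.image (rho n) := fun t => by
    rw [Finset.image_image]
    rfl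
  constructor
  · intro h
    obtain ⟨t, ht, hts⟩ := exists_face_lift h
    refine ⟨t, ht, Finset.coe_injective ?_⟩
    -- The lifted simplex is known only to have the same image in `ℤⁿ` as `s`; injectivity on
    -- vertices makes its set of orbits equal to `s`.
    refine (orbitRho_injOn.image_eq_image_iff ?_ hs).1 ?_
    · intro q hq
      obtain ⟨v, hv, rfl⟩ := Finset.mem_image.1 (Finset.mem_coe.1 hq)
      exact (quotientVertex _ _ (actsSimplicially n) ⟨v, ((piComplex n).isRelLowerSet_faces ht).2
        (Finset.singleton_subset_iff.2 hv) (Finset.singleton_nonempty v)⟩).2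
    · rw [← Finset.coe_image, ← Finset.coe_image, himage, Finset.coe_image, hts]
  · rintro ⟨t, ht, rfl⟩
    rw [himage]
    exact image_rho_mem_faces ht

theorem bijOn_orbitRho : Set.BijOn (orbitRho n) (vertices (quotientComplex
    (palindromicTorelli n) (piComplex n) (actsSimplicially n))) (vertices (piComplexZ n)) := by
  classical
  refine ⟨fun q hq => ?_, orbitRho_injOn, fun u hu => ?_⟩
  · have := (image_orbitRho_mem_faces_iff {q} (by simpa using hq)).2 hq
    rwa [Finset.image_singleton] at this
  · obtain ⟨t, ht, h⟩ := exists_face_lift hu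
    have hu' : u ∈ rho n '' (t : Set (FreeGroup (Fin n))) := by simp [h]
    obtain ⟨v, hv, rfl⟩ := hu'
    exact ⟨Quotient.mk _ v, (quotientVertex _ _ (actsSimplicially n)
      ⟨v, ((piComplex n).isRelLowerSet_faces ht).2
        (Finset.singleton_subset_iff.2 hv) (Finset.singleton_nonempty v)⟩).2, rfl⟩

/-- The isomorphism from the quotient of the complex of partial π-bases of `F_n` to the complex
of partial π-bases of `ℤⁿ` induced by abelianisation. -/
noncomputable def quotientIso (n : ℕ) : SimplicialIso
    (quotientComplex (palindromicTorelli n) (piComplex n) (actsSimplicially n))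
    (piComplexZ n) where
  toEquiv := bijOn_orbitRho.equiv (orbitRho n)
  map_faces_iff s := by
    classical
    rw [← image_orbitRho_mem_faces_iff _ (by simp)]
    refine iff_of_eq (congrArg (· ∈ (piComplexZ n).faces) ?_)
    simp only [Finset.map_eq_image, Finset.image_image]
    rfl

end PalindromicTorelli

open PalindromicTorelli in
/-- The quotient of the complex of partial π-bases of `F_n` by the palindromic Torelli group is
isomorphic, as a simplicial complex, to the complex of partial π-bases of `ℤⁿ`, by an isomorphism
induced by abelianisation. The last two clauses say that the combinatorial quotient complex is
the genuine orbit space: distinct vertices of a simplex lie in distinct orbits, and two simplices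
that have the same vertices in the quotient lie in the same orbit. -/
theorem mainTheorem7 (n : ℕ) :
    (∃ e : SimplicialIso
        (quotientComplex (palindromicTorelli n) (piComplex n) (actsSimplicially n))
        (piComplexZ n),
      ∀ v : vertices (piComplex n),
        (e.toEquiv (quotientVertex (palindromicTorelli n) (piComplex n) (actsSimplicially n) v) :
          Fin n → ℤ) = rho n v) ∧
    (∀ s ∈ (piComplex n).faces, ∀ v ∈ s, ∀ w ∈ s,
      v ∈ MulAction.orbit (palindromicTorelli n) w → v = w) ∧
    (∀ s ∈ (piComplex n).faces, ∀ t ∈ (piComplex n).faces,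
      (∀ v ∈ s, ∃ w ∈ t, v ∈ MulAction.orbit (palindromicTorelli n) w) →
      (∀ w ∈ t, ∃ v ∈ s, w ∈ MulAction.orbit (palindromicTorelli n) v) →
      ∃ φ : palindromicTorelli n, s.map (MulAction.toPerm φ).toEmbedding = t) := by
  refine ⟨⟨quotientIso n, fun v => rfl⟩, ?_, ?_⟩
  · rintro s ⟨-, B, hB, hsB⟩ v hv w hw h
    exact hB.injOn_rho (hsB hv) (hsB hw) (rho_eq_of_mem_orbit h)
  · intro s hs t ht h1 h2
    refine exists_torelli_of_image_rho_eq hs ht (Set.Subset.antisymm ?_ ?_)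
    · rintro _ ⟨v, hv, rfl⟩
      obtain ⟨w, hw, h⟩ := h1 v hv
      exact ⟨w, hw, (rho_eq_of_mem_orbit h).symm⟩
    · rintro _ ⟨w, hw, rfl⟩
      obtain ⟨v, hv, h⟩ := h2 w hw
      exact ⟨v, hv, (rho_eq_of_mem_orbit h).symm⟩
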